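/- Let $d,M\ge 1$ be integers, let $n\ge 0$ be an integer, let $t_1,\dots,t_M\in[0,1)^d$ be pairwise distinct, let $\hat f_1,\dots,\hat f_M\in\mathbb{C}\setminus\{0\}$, and let $$z_j:=(e^{2\pi i t_{j,1}},\dots,e^{2\pi i t_{j,d}})\in\mathbb{C}^d,\qquad q:=\min_{r\in\mathbb{Z}^d,\ j\ne\ell}\|t_j-t_\ell+r\|_\infty ,$$ where $q:=\infty$ (and $0\cdot\infty:=0$) if $M=1$. Let $f(k):=\sum_{j=1}^M\hat f_j z_j^k$, $k\in\mathbb{Z}^d$, be the trigonometric moments, let $A_n:=(z_j^k)_{j=1,\dots,M;\ k\in\mathbb{N}_0^d,\|k\|_\infty\le n}\in\mathbb{C}^{M\times(n+1)^d}$ and $D:=\operatorname{diag}(\hat f_1,\dots,\hat f_M)$, and let $$T_n:=A_n^*DA_n=\big(f(\ell-k)\big)_{k,\ell\in\mathbb{N}_0^d,\ \|k\|_\infty,\|\ell\|_\infty\le n}\in\mathbb{C}^{(n+1)^d\times(n+1)^d}$$ ($k$ is the row index and $\ell$ the column index). Identify a vector $(p_k)\in\mathbb{C}^{(n+1)^d}$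 with the polynomial $p(z)=\sum_{\|k\|_\infty\le n}p_kz^k$, and for $K\subset\mathbb{C}^{(n+1)^d}$ let $V(K):=\{z\in\mathbb{C}^d: p(z)=0\text{ for all }p\in K\}$. Let $$c_d:=2\min\Big\{\tfrac12\,d^{1/2},\ \tfrac{\sigma}{\pi}\,d^{1/4},\ \min_{p\in\{2,4,6,\dots\}}C_p\,d^{1/p}\Big\},\qquad C_p:=\left(\frac{\Gamma(\frac p2+1)\,\Gamma(p+\frac32)}{\pi^p\,\Gamma(\frac{p+3}2)}\right)^{1/p},$$ where $\sigma\approx 2.365$ is the smallest positive root of $\cos t\sinh t+\cosh t\sin t$. If $(n-1)q>c_d$ or $(n-1)q>3+2\log d$, then $$V(\ker T_n)=\{z_1,\dots,z_M\}.$$ Hence multivariate Prony's method identifies the parameters from the moments $f(k)$, $\|k\|_\infty\le n$: the points $t\in[0,1)^d$ with $(e^{2\pi i t_1},\dots,e^{2\pi i t_d})\in V(\ker T_n)$ are exactly $t_1,\dots,t_M$. -/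

import Mathlib

noncomputable section

namespace Prony

open scoped Matrix

/-- The parameterization `t ↦ (exp (2πi t₁), …, exp (2πi t_d))` of the torus. -/
def torusPoint {d : ℕ} (t : Fin d → ℝ) : Fin d → ℂ :=
  fun i => Complex.exp (2 * Real.pi * Complex.I * (t i : ℂ))

/-- The half-open cube `[0,1)^d`. -/
def unitCube (d : ℕ) : Set (Fin d → ℝ) := {t | ∀ i, t i ∈ Set.Ico (0 : ℝ) 1}

/-- The wrap-around separation distance, the minimum of `‖t_j - t_ℓ + r‖_∞` over `j ≠ ℓ` and
`r ∈ ℤ^d` (the norm of `Fin d → ℝ` is the maximum norm).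
It is extended-real-valued: for a single parameter it is `⊤`, the infimum of the empty set. -/
def sepDist {d M : ℕ} (t : Fin M → Fin d → ℝ) : EReal :=
  ⨅ (j : Fin M) (l : Fin M) (_ : j ≠ l) (r : Fin d → ℤ),
    ((‖t j - t l + (fun i => (r i : ℝ))‖ : ℝ) : EReal)

/-- The trigonometric moments `f(k) = ∑_j c_j z_j^k`, `k ∈ ℤ^d`, of `∑_j c_j δ_{t_j}`. -/
def moment {d M : ℕ} (t : Fin M → Fin d → ℝ) (c : Fin M → ℂ) (k : Fin d → ℤ) : ℂ :=
  ∑ j, c j * ∏ i, torusPoint (t j) i ^ k i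

/-- The indices `k ∈ ℕ₀^d` with `‖k‖_∞ ≤ n`. -/
abbrev Idx (d n : ℕ) : Type := Fin d → Fin (n + 1)

/-- The value at `z` of the polynomial `∑_k p_k z^k` of max-degree at most `n` with
coefficient vector `p`. -/
def evalPoly {d n : ℕ} (p : Idx d n → ℂ) (z : Fin d → ℂ) : ℂ :=
  ∑ k, p k * ∏ i, z i ^ (k i : ℕ)

/-- The common zero set in `ℂ^d` of a set of polynomials of max-degree at most `n`, these being
identified with their coefficient vectors. -/
def commonZeros {d n : ℕ} (K : Set (Idx d n → ℂ)) : Set (Fin d → ℂ) :=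
  {z | ∀ p ∈ K, evalPoly p z = 0}

/-- The multilevel Toeplitz matrix of order `n` of a sequence `f` on `ℤ^d`. Its entry in row `k`
and column `l` is `f (l - k)`; for the moment sequence this is `Aᴴ D A`,
see `toeplitz_moment`. It only involves the `f k` with `‖k‖_∞ ≤ n`. -/
def toeplitz {d : ℕ} (n : ℕ) (f : (Fin d → ℤ) → ℂ) : Matrix (Idx d n) (Idx d n) ℂ :=
  Matrix.of fun k l => f (fun i => ((l i : ℕ) : ℤ) - ((k i : ℕ) : ℤ))

/-- The Vandermonde matrix `(z_j^k)` with rows `j` and columns `k ∈ ℕ₀^d`, `‖k‖_∞ ≤ n`. -/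
def vandermonde {d M : ℕ} (n : ℕ) (t : Fin M → Fin d → ℝ) : Matrix (Fin M) (Idx d n) ℂ :=
  Matrix.of fun j k => ∏ i, torusPoint (t j) i ^ (k i : ℕ)

theorem toeplitz_moment {d M : ℕ} (n : ℕ) (t : Fin M → Fin d → ℝ) (c : Fin M → ℂ) :
    toeplitz n (moment t c) = (vandermonde n t)ᴴ * Matrix.diagonal c * vandermonde n t := by
  have hconj : ∀ (s : Fin d → ℝ) (i : Fin d), star (torusPoint s i) = (torusPoint s i)⁻¹ := by
    intro s i
    have h2 : (starRingEnd ℂ) 2 = 2 := Complex.conj_ofNat 2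
    simp [torusPoint, ← Complex.exp_conj, ← Complex.exp_neg, h2]
  have hne : ∀ (s : Fin d → ℝ) (i : Fin d), torusPoint s i ≠ 0 :=
    fun s i => Complex.exp_ne_zero _
  ext k l
  rw [Matrix.mul_apply]
  simp only [Matrix.mul_diagonal, toeplitz, moment, vandermonde, Matrix.of_apply,
    Matrix.conjTranspose_apply, star_prod, star_pow, hconj]
  refine Finset.sum_congr rfl fun j _ => ?_
  rw [mul_comm _ (c j), mul_assoc, ← Finset.prod_mul_distrib]
  congr 1
  refine Finset.prod_congr rfl fun i _ => ?_
  rw [zpow_sub₀ (hne _ _), zpow_natCast, zpow_natCast, inv_pow, div_eq_inv_mul]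

/-- `C_p = (Γ(p/2+1) Γ(p+3/2) / (π^p Γ((p+3)/2)))^{1/p}`. -/
def C (p : ℕ) : ℝ :=
  (Real.Gamma ((p : ℝ) / 2 + 1) * Real.Gamma ((p : ℝ) + 3 / 2) /
    (Real.pi ^ p * Real.Gamma (((p : ℝ) + 3) / 2))) ^ (1 / (p : ℝ))

/-- The first positive root (about `2.365`) of `cos t sinh t + cosh t sin t`. -/
def σ : ℝ :=
  sInf {t : ℝ | 0 < t ∧ Real.cos t * Real.sinh t + Real.cosh t * Real.sin t = 0}

/-- The constant `c_d`: twice the minimum of `C_p d^{1/p}` over the positive even integers `p`,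
where `C_2` and `C_4` are improved to `1/2` and `σ/π`, respectively. -/
def sepConst (d : ℕ) : ℝ :=
  2 * min (1 / 2 * (d : ℝ) ^ (1 / 2 : ℝ))
    (min (σ / Real.pi * (d : ℝ) ^ (1 / 4 : ℝ))
      (⨅ p : {p : ℕ // 0 < p ∧ Even p}, C p * (d : ℝ) ^ (1 / ((p : ℕ) : ℝ))))

end Prony

end

noncomputable section

/-! ### Parseval's identity for translated bumps, and uniqueness from low-order moments -/

namespace Prony

open MeasureTheory AddCircle

/-! Put `N = n - 1`. The analytic core (`eq_zero_of_moments_eq_zero`) is that the rows of the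
Vandermonde matrix of order `N` are independent. Suppose `u` annihilates them. Take a bump `B₀` on
the circle supported in `‖x‖ < q / 2` and place the tensor product of `d` copies at each node with
weight `u j`. The separation makes the supports disjoint, so the squared L² norm of the sum is
`‖u‖²` times that of one tensor bump. On the Fourier side the coefficient at `k` is the product of
the bump coefficients with an exponential sum in `u`, which vanishes on the box `-N ≤ k i ≤ 0`.
Outside that box some `|k i + N / 2|` is at least `N / 2`, so the sum of the squared L² norms
obtained by differentiating `m` times in one coordinate at a time (about the frequency `-N / 2`)
dominates `(π N)^(2m)` times the original one. If the bump has energy quotient `R` on `[-1, 1]`,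
this forces `u = 0` as soon as `d R < (π N q / 2)^(2m)`.

The constants come from the choice of profile: `cos (π x / 2)` for `m = 1`, the clamped-beam
eigenfunction for `m = 2`, and `(1 - x²)^m` for general `m`. The logarithmic condition follows from
the last family with `2m` close to `log d`.

The rest is algebra. Row independence gives Lagrange polynomials `p j` of max-degree `N`. The
polynomials `(z i - z_j i) p j` and `1 - ∑ p j` have max-degree at most `n` and vanish at the nodes,
and they have no other common zero. Row independence also holds at order `n`, so `ker (Aᴴ D A) = ker
A` is exactly the space of polynomials vanishing at the nodes. -/

lemma memLp_shiftedProd {d : ℕ} {B : Fin d → UnitAddCircle → ℂ}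
    (hm : ∀ i, Measurable (B i)) (hb : ∀ i, ∃ K, ∀ x, ‖B i x‖ ≤ K) (s : Fin d → UnitAddCircle)
    (p : ENNReal) :
    MemLp (fun x : Fin d → UnitAddCircle => ∏ i, B i (x i - s i)) p
      (Measure.pi fun _ => haarAddCircle) := by
  choose K hK using hb
  refine MemLp.of_bound (C := ∏ i, K i) ?_ (Filter.Eventually.of_forall fun x => ?_)
  · have : Measurable (fun x : Fin d → UnitAddCircle => ∏ i, B i (x i - s i)) :=
      Finset.measurable_prod _ fun i _ =>
        (hm i).comp (show Measurable fun x : Fin d → UnitAddCircle => x i - s i from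
          (measurable_pi_apply (X := fun _ : Fin d => UnitAddCircle) i).sub_const (s i))
    exact this.aestronglyMeasurable
  · rw [norm_prod]
    exact Finset.prod_le_prod (fun _ _ => norm_nonneg _) fun i _ => hK i _

/-- Parseval's identity on the torus for a bare square integrable function. -/
lemma hasSum_sq_integral_mFourier {d : ℕ} {G : (Fin d → UnitAddCircle) → ℂ}
    (hG : MemLp G 2 (Measure.pi fun _ => haarAddCircle)) :
    HasSum (fun k : Fin d → ℤ =>
        ‖∫ x, (∏ i, fourier (-k i) (x i)) * G x ∂(Measure.pi fun _ => haarAddCircle)‖ ^ 2)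
      (∫ x, ‖G x‖ ^ 2 ∂(Measure.pi fun _ => haarAddCircle)) := by
  have h := UnitAddTorus.hasSum_sq_mFourierCoeff (d := Fin d) (hG.toLp G)
  have e := hG.coeFn_toLp
  convert h using 1
  · funext k
    congr 2
    refine integral_congr_ae ?_
    filter_upwards [e] with x hx
    rw [hx]
    rfl
  · refine integral_congr_ae ?_
    filter_upwards [e] with x hx
    rw [hx]

lemma fourierCoeff_translate (B : UnitAddCircle → ℂ) (s : UnitAddCircle) (k : ℤ) :
    ∫ x, fourier (-k) x * B (x - s) ∂haarAddCircle = fourier (-k) s * fourierCoeff B k := by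
  rw [fourierCoeff, ← integral_const_mul,
    ← integral_sub_right_eq_self (fun x => fourier (-k) s * (fourier (-k) x • B x)) s]
  refine integral_congr_ae (Filter.Eventually.of_forall fun x => ?_)
  have : (fourier (-k) x : ℂ) = fourier (-k) s * fourier (-k) (x - s) := by
    simp only [fourier_apply, ← Circle.coe_mul, ← toCircle_add, ← smul_add]
    simp
  simp only [smul_eq_mul]
  rw [this]
  ring

lemma integral_fourier_mul_sum {d M : ℕ} {B : Fin d → UnitAddCircle → ℂ}
    (hm : ∀ i, Measurable (B i)) (hb : ∀ i, ∃ K, ∀ x, ‖B i x‖ ≤ K)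
    (s : Fin M → Fin d → UnitAddCircle) (u : Fin M → ℂ) (k : Fin d → ℤ) :
    ∫ x, (∏ i, fourier (-k i) (x i)) * (∑ j, u j * ∏ i, B i (x i - s j i))
        ∂(Measure.pi fun _ => haarAddCircle) =
      (∑ j, u j * ∏ i, fourier (-k i) (s j i)) * ∏ i, fourierCoeff (B i) (k i) := by
  have e : ∀ x : Fin d → UnitAddCircle,
      (∏ i, (fourier (-k i) (x i) : ℂ)) * (∑ j, u j * ∏ i, B i (x i - s j i)) =
        ∑ j, u j * ∏ i, (fourier (-k i) (x i) * B i (x i - s j i)) := by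
    intro x
    rw [Finset.mul_sum]
    refine Finset.sum_congr rfl fun j _ => ?_
    rw [Finset.prod_mul_distrib]
    ring
  simp_rw [e]
  rw [integral_finsetSum]
  · rw [Finset.sum_mul]
    refine Finset.sum_congr rfl fun j _ => ?_
    rw [integral_const_mul, integral_fintype_prod_eq_prod
      (fun i x => (fourier (-k i) x : ℂ) * B i (x - s j i))]
    simp_rw [fourierCoeff_translate, Finset.prod_mul_distrib]
    ring
  · intro j _
    refine Integrable.const_mul ?_ _
    refine Integrable.fintype_prod (f := fun i x => (fourier (-k i) x : ℂ) * B i (x - s j i))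
      fun i => ?_
    obtain ⟨K, hK⟩ := hb i
    refine Integrable.of_bound (C := K) ?_ (Filter.Eventually.of_forall fun x => ?_)
    · exact (((fourier (-k i)).continuous.measurable).mul
        ((hm i).comp (measurable_id.sub_const _))).aestronglyMeasurable
    · rw [norm_mul, fourier_apply, Circle.norm_coe, one_mul]
      exact hK _

/-- The supports lie in open cubes of half-side `q / 2` around `a` and `b`, which are disjoint once
one coordinate of `a - b` has norm at least `q`. -/
lemma shiftedProd_mul_eq_zero {d : ℕ} {B : Fin d → UnitAddCircle → ℂ} {q : ℝ}
    (hs : ∀ i x, B i x ≠ 0 → ‖x‖ < q / 2) {a b : Fin d → UnitAddCircle}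
    (hab : ∃ i, q ≤ ‖a i - b i‖) (x : Fin d → UnitAddCircle) :
    (∏ i, B i (x i - a i)) = 0 ∨ (∏ i, B i (x i - b i)) = 0 := by
  by_contra! h
  obtain ⟨i, hi⟩ := hab
  have h1 := hs i _ (Finset.prod_ne_zero_iff.1 h.1 i (Finset.mem_univ _))
  have h2 := hs i _ (Finset.prod_ne_zero_iff.1 h.2 i (Finset.mem_univ _))
  have h3 := norm_sub_le (x i - b i) (x i - a i)
  rw [sub_sub_sub_cancel_left] at h3
  linarith

lemma norm_sq_sum_of_mul_eq_zero {M : ℕ} (v : Fin M → ℂ)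
    (h : ∀ j l, j ≠ l → v j = 0 ∨ v l = 0) : ‖∑ j, v j‖ ^ 2 = ∑ j, ‖v j‖ ^ 2 := by
  by_cases h0 : ∃ j, v j ≠ 0
  · obtain ⟨j, hj⟩ := h0
    have hz : ∀ l, l ≠ j → v l = 0 := fun l hl => (h l j hl).resolve_right hj
    rw [Finset.sum_eq_single j (fun l _ hl => hz l hl) (by simp),
      Finset.sum_eq_single j (fun l _ hl => by simp [hz l hl]) (by simp)]
  · push Not at h0
    simp [h0]

lemma integral_norm_sq_sum {d M : ℕ} {B : Fin d → UnitAddCircle → ℂ} {q : ℝ}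
    (hm : ∀ i, Measurable (B i)) (hb : ∀ i, ∃ K, ∀ x, ‖B i x‖ ≤ K)
    (hs : ∀ i x, B i x ≠ 0 → ‖x‖ < q / 2) (s : Fin M → Fin d → UnitAddCircle)
    (hsep : ∀ j l, j ≠ l → ∃ i, q ≤ ‖s j i - s l i‖) (u : Fin M → ℂ) :
    ∫ x, ‖∑ j, u j * ∏ i, B i (x i - s j i)‖ ^ 2 ∂(Measure.pi fun _ => haarAddCircle) =
      (∑ j, ‖u j‖ ^ 2) * ∏ i, ∫ x, ‖B i x‖ ^ 2 ∂haarAddCircle := by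
  have e : ∀ x : Fin d → UnitAddCircle, ‖∑ j, u j * ∏ i, B i (x i - s j i)‖ ^ 2 =
      ∑ j, ‖u j‖ ^ 2 * ∏ i, ‖B i (x i - s j i)‖ ^ 2 := by
    intro x
    rw [norm_sq_sum_of_mul_eq_zero]
    · refine Finset.sum_congr rfl fun j _ => ?_
      rw [norm_mul, mul_pow, norm_prod, Finset.prod_pow]
    · intro j l hjl
      rcases shiftedProd_mul_eq_zero hs (hsep j l hjl) x with h | h
      · left; rw [h, mul_zero]
      · right; rw [h, mul_zero]
  simp_rw [e]
  rw [integral_finsetSum, Finset.sum_mul]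
  · refine Finset.sum_congr rfl fun j _ => ?_
    rw [integral_const_mul, integral_fintype_prod_eq_prod (fun i x => ‖B i (x - s j i)‖ ^ 2)]
    congr 1
    exact Finset.prod_congr rfl fun i _ =>
      integral_sub_right_eq_self (fun x => ‖B i x‖ ^ 2) (s j i)
  · intro j _
    refine Integrable.const_mul ?_ _
    refine Integrable.fintype_prod (f := fun i x => ‖B i (x - s j i)‖ ^ 2) fun i => ?_
    obtain ⟨K, hK⟩ := hb i
    refine Integrable.of_bound (C := K ^ 2) ?_ (Filter.Eventually.of_forall fun x => ?_)
    · exact (((hm i).comp (measurable_id.sub_const _)).norm.pow_const 2).aestronglyMeasurable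
    · rw [Real.norm_of_nonneg (by positivity)]
      exact pow_le_pow_left₀ (norm_nonneg _) (hK _) 2

/-- Parseval's identity for a combination of translated tensor-product bumps with disjoint
supports. -/
theorem hasSum_sq_translates {d M : ℕ} {B : Fin d → UnitAddCircle → ℂ} {q : ℝ}
    (hm : ∀ i, Measurable (B i)) (hb : ∀ i, ∃ K, ∀ x, ‖B i x‖ ≤ K)
    (hs : ∀ i x, B i x ≠ 0 → ‖x‖ < q / 2) (s : Fin M → Fin d → UnitAddCircle)
    (hsep : ∀ j l, j ≠ l → ∃ i, q ≤ ‖s j i - s l i‖) (u : Fin M → ℂ) :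
    HasSum (fun k : Fin d → ℤ => ‖∑ j, u j * ∏ i, fourier (-k i) (s j i)‖ ^ 2 *
        ∏ i, ‖fourierCoeff (B i) (k i)‖ ^ 2)
      ((∑ j, ‖u j‖ ^ 2) * ∏ i, ∫ x, ‖B i x‖ ^ 2 ∂haarAddCircle) := by
  have hG : MemLp (fun x : Fin d → UnitAddCircle => ∑ j, u j * ∏ i, B i (x i - s j i)) 2
      (Measure.pi fun _ => haarAddCircle) :=
    memLp_finsetSum _ fun j _ => (memLp_shiftedProd hm hb (s j) 2).const_mul (u j)
  have h := hasSum_sq_integral_mFourier hG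
  simp_rw [integral_fourier_mul_sum hm hb s u] at h
  rw [integral_norm_sq_sum hm hb hs s hsep u] at h
  simpa only [norm_mul, norm_prod, mul_pow, Finset.prod_pow] using h

/-- Uniqueness from low-order moments, given one bump `B₀` and its modulated derivative `B₁`. -/
theorem eq_zero_of_moments_eq_zero {d M m N : ℕ} {q : ℝ} {B₀ B₁ : UnitAddCircle → ℂ}
    (hm₀ : Measurable B₀) (hm₁ : Measurable B₁)
    (hb₀ : ∃ K, ∀ x, ‖B₀ x‖ ≤ K) (hb₁ : ∃ K, ∀ x, ‖B₁ x‖ ≤ K)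
    (hs₀ : ∀ x, B₀ x ≠ 0 → ‖x‖ < q / 2) (hs₁ : ∀ x, B₁ x ≠ 0 → ‖x‖ < q / 2)
    (hcoeff : ∀ k : ℤ, ‖fourierCoeff B₁ k‖ =
      (2 * Real.pi * |(k : ℝ) + N / 2|) ^ m * ‖fourierCoeff B₀ k‖)
    (hpos : 0 < ∫ x, ‖B₀ x‖ ^ 2 ∂haarAddCircle)
    (hlt : d * ∫ x, ‖B₁ x‖ ^ 2 ∂haarAddCircle <
      (Real.pi * N) ^ (2 * m) * ∫ x, ‖B₀ x‖ ^ 2 ∂haarAddCircle)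
    (s : Fin M → Fin d → UnitAddCircle)
    (hsep : ∀ j l, j ≠ l → ∃ i, q ≤ ‖s j i - s l i‖) (u : Fin M → ℂ)
    (hu : ∀ k : Fin d → ℕ, (∀ i, k i ≤ N) → ∑ j, u j * ∏ i, fourier (k i : ℤ) (s j i) = 0) :
    u = 0 := by
  classical
  set I₀ := ∫ x, ‖B₀ x‖ ^ 2 ∂haarAddCircle
  set I₁ := ∫ x, ‖B₁ x‖ ^ 2 ∂haarAddCircle
  set F : (Fin d → ℤ) → ℝ := fun k => ‖∑ j, u j * ∏ i, fourier (-k i) (s j i)‖ ^ 2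
  set P : (Fin d → ℤ) → ℝ := fun k => ∏ i, ‖fourierCoeff B₀ (k i)‖ ^ 2
  set U := ∑ j, ‖u j‖ ^ 2
  have h0 : HasSum (fun k => F k * P k) (U * I₀ ^ d) := by
    have h := hasSum_sq_translates (B := fun _ => B₀) (fun _ => hm₀) (fun _ => hb₀)
      (fun _ => hs₀) s hsep u
    rwa [Finset.prod_const, Finset.card_univ, Fintype.card_fin] at h
  have h1 : ∀ i : Fin d, HasSum
      (fun k => (2 * Real.pi * |(k i : ℝ) + N / 2|) ^ (2 * m) * (F k * P k))
      (U * (I₁ * I₀ ^ (d - 1))) := by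
    intro i
    -- Using `B₁` in coordinate `i` alone multiplies the `k`-th Parseval term by the symbol in `k i`
    -- and replaces one factor `I₀` by `I₁`.
    have h := hasSum_sq_translates (B := fun l => if l = i then B₁ else B₀)
      (fun l => by split_ifs <;> assumption) (fun l => by split_ifs <;> assumption)
      (fun l => by split_ifs <;> assumption) s hsep u
    convert h using 1
    · funext k
      simp only [F, P]
      rw [← Finset.mul_prod_erase _ _ (Finset.mem_univ i),
        ← Finset.mul_prod_erase (a := i) (f := fun l =>
          ‖fourierCoeff (if l = i then B₁ else B₀) (k l)‖ ^ 2) _ (Finset.mem_univ i)]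
      rw [Finset.prod_congr rfl (g := fun l => ‖fourierCoeff B₀ (k l)‖ ^ 2)
        (fun l hl => by rw [if_neg (Finset.ne_of_mem_erase hl)]) (s₁ := Finset.univ.erase i)
        (f := fun l => ‖fourierCoeff (if l = i then B₁ else B₀) (k l)‖ ^ 2)]
      rw [if_pos rfl, hcoeff]
      ring
    · rw [← Finset.mul_prod_erase (a := i) _ _ (Finset.mem_univ i), if_pos rfl,
        Finset.prod_congr rfl (g := fun _ => I₀)
        (fun l hl => by rw [if_neg (Finset.ne_of_mem_erase hl)]) (s₁ := Finset.univ.erase i)]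
      simp [I₁, U]
  have h2 := hasSum_sum (s := Finset.univ) fun (i : Fin d) _ => h1 i
  have h3 := h0.mul_left ((Real.pi * N) ^ (2 * m))
  have hle : (Real.pi * N) ^ (2 * m) * (U * I₀ ^ d) ≤ ∑ _i : Fin d, U * (I₁ * I₀ ^ (d - 1)) := by
    refine hasSum_le (fun k => ?_) h3 h2
    rw [← Finset.sum_mul]
    have hFP : 0 ≤ F k * P k := by positivity
    -- The exponential sum `F k` uses frequency `-k`, so the moments with indices in `[0, N]` kill
    -- it on `[-N, 0]^d`, a box centred at `-N / 2`.
    by_cases hk : ∀ i, k i ≤ 0 ∧ -(N : ℤ) ≤ k i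
    · have hF : F k = 0 := by
        have := hu (fun i => (-k i).toNat) (fun i => by have := hk i; omega)
        have e : ∀ i, (((-k i).toNat : ℕ) : ℤ) = -k i := fun i => by have := hk i; omega
        simp only [e] at this
        simp only [F, this]
        simp
      simp [hF]
    · push Not at hk
      obtain ⟨i, hi⟩ := hk
      refine mul_le_mul_of_nonneg_right ?_ hFP
      refine le_trans ?_ (Finset.single_le_sum (f := fun i : Fin d =>
        (2 * Real.pi * |(k i : ℝ) + N / 2|) ^ (2 * m)) (fun _ _ => by positivity)
        (Finset.mem_univ i))
      refine pow_le_pow_left₀ (by positivity) ?_ _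
      have : (N : ℝ) / 2 ≤ |(k i : ℝ) + N / 2| := by
        by_cases h : k i ≤ 0
        · have h' := hi h
          have : (k i : ℝ) < -N := by exact_mod_cast h'
          rw [le_abs]; right; linarith
        · have : (0 : ℝ) < k i := by exact_mod_cast not_le.1 h
          rw [le_abs]; left; linarith
      have hpi := Real.pi_pos
      nlinarith
  rw [Finset.sum_const, Finset.card_univ, Fintype.card_fin, nsmul_eq_mul] at hle
  have hd : 0 < d ∨ d = 0 := by omega
  have hU : U = 0 := by
    by_contra hne
    have hUpos : 0 < U := lt_of_le_of_ne (by positivity) (Ne.symm hne)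
    rcases hd with hd | rfl
    · have e : I₀ ^ d = I₀ * I₀ ^ (d - 1) := by
        rw [← pow_succ']; congr 1; omega
      rw [e] at hle
      have hp : 0 < U * I₀ ^ (d - 1) := by positivity
      have := mul_lt_mul_of_pos_right hlt hp
      nlinarith
    · simp at hle hlt
      have := mul_pos (pos_of_mul_pos_left hlt hpos.le) hUpos
      linarith
  funext j
  have := (Finset.sum_eq_zero_iff_of_nonneg (fun j _ => by positivity)).1 hU j (Finset.mem_univ j)
  simpa using this

end Prony

/-! ### Periodized bumps built from a profile on `[-1, 1]` -/

namespace Prony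

open MeasureTheory AddCircle

/-- The restriction of `ψ` to `(-q/2, q/2)`, extended by zero and made `1`-periodic. -/
def periodicBump (q : ℝ) (ψ : ℝ → ℂ) : UnitAddCircle → ℂ :=
  liftIoc 1 (-(1 / 2)) ((Set.Ioo (-(q / 2)) (q / 2)).indicator ψ)

lemma periodicBump_apply (q : ℝ) (ψ : ℝ → ℂ) (x : UnitAddCircle) :
    periodicBump q ψ x = (Set.Ioo (-(q / 2)) (q / 2)).indicator ψ (equivIoc 1 (-(1 / 2)) x) :=
  rfl

lemma measurable_periodicBump (q : ℝ) {ψ : ℝ → ℂ} (hψ : Continuous ψ) :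
    Measurable (periodicBump q ψ) :=
  (hψ.measurable.indicator measurableSet_Ioo).comp
    (measurable_subtype_coe.comp (measurableEquivIoc 1 (-(1 / 2))).measurable)

lemma periodicBump_bounded (q : ℝ) {ψ : ℝ → ℂ} (hψ : Continuous ψ) :
    ∃ K, ∀ x, ‖periodicBump q ψ x‖ ≤ K := by
  obtain ⟨K, hK⟩ := (isCompact_Icc (a := -(q / 2)) (b := q / 2)).exists_bound_of_continuousOn
    hψ.continuousOn
  refine ⟨max K 0, fun x => ?_⟩
  rw [periodicBump_apply]
  by_cases h : ((equivIoc 1 (-(1 / 2)) x : ℝ)) ∈ Set.Ioo (-(q / 2)) (q / 2)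
  · rw [Set.indicator_of_mem h]
    exact (hK _ (Set.Ioo_subset_Icc_self h)).trans (le_max_left _ _)
  · rw [Set.indicator_of_notMem h]
    simp

lemma norm_lt_of_periodicBump_ne_zero {q : ℝ} {ψ : ℝ → ℂ} {x : UnitAddCircle}
    (hx : periodicBump q ψ x ≠ 0) : ‖x‖ < q / 2 := by
  rw [periodicBump_apply] at hx
  have h := Set.mem_of_indicator_ne_zero hx
  have e : ((equivIoc 1 (-(1 / 2)) x : ℝ) : UnitAddCircle) = x := coe_equivIoc
  have hm := (equivIoc (1 : ℝ) (-(1 / 2)) x).2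
  rw [← e, (norm_coe_eq_abs_iff (1 : ℝ) one_ne_zero).2]
  · exact abs_lt.2 h
  · rw [abs_le]
    norm_num
    constructor <;> linarith [hm.1, hm.2]

/-- The condition `q ≤ 1` lets the support fit into one period. -/
lemma intervalIntegral_indicator_Ioo {E : Type*} [NormedAddCommGroup E] [NormedSpace ℝ E] {q : ℝ}
    (h0 : 0 ≤ q) (hq : q ≤ 1) (φ : ℝ → E) :
    ∫ x in (-(1 / 2) : ℝ)..(-(1 / 2) + 1), (Set.Ioo (-(q / 2)) (q / 2)).indicator φ x =
      ∫ x in (-(q / 2))..(q / 2), φ x := by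
  rw [intervalIntegral.integral_of_le (by norm_num), intervalIntegral.integral_of_le (by linarith),
    setIntegral_indicator measurableSet_Ioo, Set.inter_eq_self_of_subset_right]
  · exact setIntegral_congr_set Ioo_ae_eq_Ioc
  · intro x hx
    constructor <;> linarith [hx.1, hx.2]

lemma integral_norm_sq_periodicBump {q : ℝ} (h0 : 0 ≤ q) (hq : q ≤ 1) (ψ : ℝ → ℂ) :
    ∫ x, ‖periodicBump q ψ x‖ ^ 2 ∂haarAddCircle = ∫ x in (-(q / 2))..(q / 2), ‖ψ x‖ ^ 2 := by
  rw [integral_haarAddCircle, ← intervalIntegral_indicator_Ioo h0 hq,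
    ← integral_liftIoc_eq_intervalIntegral]
  simp only [inv_one, one_smul]
  congr 1
  funext x
  rw [periodicBump_apply]
  simp only [liftIoc, Function.comp, Set.domRestrict_apply]
  by_cases h : ((equivIoc 1 (-(1 / 2)) x : ℝ)) ∈ Set.Ioo (-(q / 2)) (q / 2)
  · rw [Set.indicator_of_mem h, Set.indicator_of_mem h]
  · rw [Set.indicator_of_notMem h, Set.indicator_of_notMem h]
    simp

lemma fourierCoeff_periodicBump {q : ℝ} (h0 : 0 ≤ q) (hq : q ≤ 1) (ψ : ℝ → ℂ) (k : ℤ) :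
    fourierCoeff (periodicBump q ψ) k =
      ∫ x in (-(q / 2))..(q / 2), ψ x * Complex.exp (-(2 * Real.pi * Complex.I * k) * x) := by
  rw [fourierCoeff_eq_intervalIntegral _ _ (-(1 / 2)), ← intervalIntegral_indicator_Ioo h0 hq]
  rw [div_one, one_smul]
  refine intervalIntegral.integral_congr_ae (Filter.Eventually.of_forall fun x hx => ?_)
  rw [Set.uIoc_of_le (by norm_num)] at hx
  rw [periodicBump, liftIoc_coe_apply hx, fourier_coe_apply]
  by_cases h : x ∈ Set.Ioo (-(q / 2)) (q / 2)
  · rw [Set.indicator_of_mem h, Set.indicator_of_mem h, smul_eq_mul, mul_comm]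
    congr 2
    push_cast
    ring
  · rw [Set.indicator_of_notMem h, Set.indicator_of_notMem h, smul_zero]

/-- Iterated integration by parts for chains of derivatives, without boundary terms. -/
lemma integral_iterated_by_parts {A : Type*} [NormedCommRing A] [NormedAlgebra ℝ A] [CompleteSpace A]
    {a b : ℝ} {f e : ℕ → ℝ → A}
    (hf : ∀ k x, HasDerivAt (f k) (f (k + 1) x) x) (he : ∀ k x, HasDerivAt (e k) (e (k + 1) x) x)
    (m : ℕ) (h : ∀ l < m, f l a = 0 ∧ f l b = 0) (r : ℕ) :
    ∫ x in a..b, f m x * e r x = (-1) ^ m * ∫ x in a..b, f 0 x * e (r + m) x := by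
  have cf : ∀ k, Continuous (f k) := fun k =>
    continuous_iff_continuousAt.2 fun x => (hf k x).continuousAt
  have ce : ∀ k, Continuous (e k) := fun k =>
    continuous_iff_continuousAt.2 fun x => (he k x).continuousAt
  induction m generalizing r with
  | zero => simp
  | succ m ih =>
    have h1 := intervalIntegral.integral_mul_deriv_eq_deriv_mul_of_hasDerivAt (a := a) (b := b)
      (ce r).continuousOn (cf m).continuousOn
      (fun x _ => he r x) (fun x _ => hf m x) ((ce _).intervalIntegrable _ _)
      ((cf _).intervalIntegrable _ _)
    rw [(h m (by omega)).1, (h m (by omega)).2] at h1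
    simp only [mul_zero, sub_zero, zero_sub] at h1
    have h2 := ih (fun l hl => h l (by omega)) (r + 1)
    simp only [mul_comm (f _ _)] at h2 ⊢
    rw [h1, h2, pow_succ, show r + 1 + m = r + (m + 1) by ring]
    ring

lemma hasDerivAt_exp_chain (c : ℂ) (k : ℕ) (x : ℝ) :
    HasDerivAt (fun x : ℝ => c ^ k * Complex.exp (c * x)) (c ^ (k + 1) * Complex.exp (c * x)) x := by
  have h1 : HasDerivAt (fun x : ℝ => c * (x : ℂ)) c x := by
    simpa using (Complex.ofRealCLM.hasDerivAt (x := x)).const_mul c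
  exact (h1.cexp.const_mul (c ^ k)).congr_deriv (by ring)

/-- A bump profile: a chain `g 0, g 1, …` of successive derivatives whose first `m` members
vanish at `±1`, with `∫ (g m)² = R ∫ (g 0)²` on `[-1, 1]`. -/
structure BumpProfile (m : ℕ) (R : ℝ) where
  g : ℕ → ℝ → ℝ
  hasDerivAt : ∀ k x, HasDerivAt (g k) (g (k + 1) x) x
  boundary : ∀ l < m, g l (-1) = 0 ∧ g l 1 = 0
  energy : ∫ x in (-1 : ℝ)..1, g m x ^ 2 = R * ∫ x in (-1 : ℝ)..1, g 0 x ^ 2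
  pos : 0 < ∫ x in (-1 : ℝ)..1, g 0 x ^ 2

namespace BumpProfile

variable {m : ℕ} {R : ℝ} (G : BumpProfile m R)

lemma continuous (k : ℕ) : Continuous (G.g k) :=
  continuous_iff_continuousAt.2 fun x => (G.hasDerivAt k x).continuousAt

/-- The successive derivatives of the profile rescaled to `[-q/2, q/2]`. -/
def scaled (q : ℝ) (k : ℕ) (x : ℝ) : ℂ := (((2 / q) ^ k * G.g k (2 / q * x) : ℝ) : ℂ)

lemma continuous_scaled (q : ℝ) (k : ℕ) : Continuous (G.scaled q k) :=
  Complex.continuous_ofReal.comp (continuous_const.mul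
    ((G.continuous k).comp (continuous_const.mul continuous_id)))

lemma hasDerivAt_scaled (q : ℝ) (k : ℕ) (x : ℝ) :
    HasDerivAt (G.scaled q k) (G.scaled q (k + 1) x) x := by
  refine HasDerivAt.ofReal_comp ?_
  have h1 : HasDerivAt (fun x : ℝ => 2 / q * x) (2 / q) x := by
    simpa using (hasDerivAt_id x).const_mul (2 / q)
  have h2 := ((G.hasDerivAt k (2 / q * x)).comp x h1).const_mul ((2 / q) ^ k)
  exact h2.congr_deriv (by ring)

lemma scaled_boundary {q : ℝ} (hq : 0 < q) {l : ℕ} (hl : l < m) :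
    G.scaled q l (-(q / 2)) = 0 ∧ G.scaled q l (q / 2) = 0 := by
  have e1 : 2 / q * (q / 2) = 1 := by field_simp
  have e2 : 2 / q * -(q / 2) = -1 := by field_simp
  simp only [scaled, e1, e2, (G.boundary l hl).1, (G.boundary l hl).2]
  simp

/-- The modulated, periodized `k`-th derivative of the rescaled profile. -/
def bump (q : ℝ) (N k : ℕ) : UnitAddCircle → ℂ :=
  periodicBump q fun x => G.scaled q k x * Complex.exp (-(Real.pi * Complex.I * N) * x)

lemma continuous_modulated (q : ℝ) (N k : ℕ) :
    Continuous fun x : ℝ => G.scaled q k x * Complex.exp (-(Real.pi * Complex.I * N) * x) :=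
  (G.continuous_scaled q k).mul (Complex.continuous_exp.comp
    (continuous_const.mul Complex.continuous_ofReal))

lemma integral_norm_sq_bump {q : ℝ} (hq0 : 0 < q) (hq : q ≤ 1) (N k : ℕ) :
    ∫ x, ‖G.bump q N k x‖ ^ 2 ∂haarAddCircle =
      (2 / q) ^ (2 * k) * (q / 2 * ∫ x in (-1 : ℝ)..1, G.g k x ^ 2) := by
  rw [bump, integral_norm_sq_periodicBump hq0.le hq]
  have e : ∀ x : ℝ, ‖G.scaled q k x * Complex.exp (-(Real.pi * Complex.I * N) * x)‖ ^ 2 =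
      (2 / q) ^ (2 * k) * (G.g k (2 / q * x)) ^ 2 := by
    intro x
    have : (-(Real.pi * Complex.I * N) * x : ℂ) = ((-(Real.pi * N * x) : ℝ) : ℂ) * Complex.I := by
      push_cast; ring
    rw [norm_mul, this, Complex.norm_exp_ofReal_mul_I, mul_one, scaled, Complex.norm_real,
      Real.norm_eq_abs, sq_abs]
    ring
  simp_rw [e]
  rw [intervalIntegral.integral_const_mul,
    intervalIntegral.integral_comp_mul_left (fun x => G.g k x ^ 2) (by positivity : 2 / q ≠ 0)]
  have e1 : 2 / q * (q / 2) = 1 := by field_simp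
  have e2 : 2 / q * -(q / 2) = -1 := by field_simp
  rw [e1, e2, smul_eq_mul, inv_div]

/-- Differentiation precedes modulation, so integrating by parts against the combined exponential
yields the symbol `k + N / 2` instead of `k`. The boundary terms vanish because the first `m`
derivatives are zero at the endpoints. -/
lemma fourierCoeff_bump {q : ℝ} (hq0 : 0 < q) (hq : q ≤ 1) (N : ℕ) (k : ℤ) :
    ‖fourierCoeff (G.bump q N m) k‖ =
      (2 * Real.pi * |(k : ℝ) + N / 2|) ^ m * ‖fourierCoeff (G.bump q N 0) k‖ := by
  set c : ℂ := -(2 * Real.pi * Complex.I * (k + N / 2)) with hc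
  have e : ∀ (l : ℕ) (x : ℝ), G.scaled q l x * Complex.exp (-(Real.pi * Complex.I * N) * x) *
      Complex.exp (-(2 * Real.pi * Complex.I * k) * x) = G.scaled q l x * Complex.exp (c * x) := by
    intro l x
    rw [mul_assoc, ← Complex.exp_add, hc]
    congr 2
    ring
  simp only [bump, fourierCoeff_periodicBump hq0.le hq, e]
  have h := integral_iterated_by_parts (a := -(q / 2)) (b := q / 2) (G.hasDerivAt_scaled q)
    (hasDerivAt_exp_chain c) m (fun l hl => G.scaled_boundary hq0 hl) 0
  simp only [pow_zero, one_mul, zero_add, mul_left_comm _ (c ^ m),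
    intervalIntegral.integral_const_mul] at h
  have hn : ‖c‖ = 2 * Real.pi * |(k : ℝ) + N / 2| := by
    have : (k + N / 2 : ℂ) = (((k : ℝ) + N / 2 : ℝ) : ℂ) := by push_cast; ring
    rw [hc, this, norm_neg]
    simp only [ norm_mul, Complex.norm_real, Complex.norm_I, Real.norm_eq_abs,
      abs_of_pos Real.pi_pos]
    simp
  rw [h, norm_mul, norm_mul, norm_pow, norm_pow, hn, norm_neg, norm_one, one_pow, one_mul]

end BumpProfile

theorem BumpProfile.eq_zero_of_moments {m d M N : ℕ} {R q : ℝ} (G : BumpProfile m R)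
    (hq0 : 0 < q) (hq : q ≤ 1)
    (hlt : d * R < (Real.pi * N * q / 2) ^ (2 * m))
    (s : Fin M → Fin d → UnitAddCircle)
    (hsep : ∀ j l, j ≠ l → ∃ i, q ≤ ‖s j i - s l i‖) (u : Fin M → ℂ)
    (hu : ∀ k : Fin d → ℕ, (∀ i, k i ≤ N) → ∑ j, u j * ∏ i, fourier (k i : ℤ) (s j i) = 0) :
    u = 0 := by
  refine eq_zero_of_moments_eq_zero (q := q) (m := m) (N := N)
    (B₀ := G.bump q N 0) (B₁ := G.bump q N m)
    (measurable_periodicBump q (G.continuous_modulated q N 0))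
    (measurable_periodicBump q (G.continuous_modulated q N m))
    (periodicBump_bounded q (G.continuous_modulated q N 0))
    (periodicBump_bounded q (G.continuous_modulated q N m))
    (fun x => norm_lt_of_periodicBump_ne_zero) (fun x => norm_lt_of_periodicBump_ne_zero)
    (G.fourierCoeff_bump hq0 hq N) ?_ ?_ s hsep u hu
  · rw [G.integral_norm_sq_bump hq0 hq]
    have := G.pos
    positivity
  · rw [G.integral_norm_sq_bump hq0 hq, G.integral_norm_sq_bump hq0 hq, G.energy]
    have hp : 0 < (2 / q) ^ (2 * m) * (q / 2 * ∫ x in (-1 : ℝ)..1, G.g 0 x ^ 2) := by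
      have := G.pos
      positivity
    -- Rescaling from `[-1, 1]` to `[-q/2, q/2]` multiplies the energy quotient by `(2 / q)^(2m)`.
    have e : (Real.pi * N) ^ (2 * m) = (Real.pi * N * q / 2) ^ (2 * m) * (2 / q) ^ (2 * m) := by
      rw [← mul_pow]
      congr 1
      field_simp
    have h := mul_lt_mul_of_pos_right hlt hp
    rw [e]
    simp only [mul_zero, pow_zero, one_mul]
    linarith

end Prony

/-! ### Explicit profiles and their energy quotients -/

namespace Prony

open Real

/-- A profile from a chain of derivatives with `∫ g₀ g₂ₘ = (-1)ᵐ R ∫ g₀²`. -/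
def BumpProfile.ofIntegral {m : ℕ} {R : ℝ} (g : ℕ → ℝ → ℝ)
    (hg : ∀ k x, HasDerivAt (g k) (g (k + 1) x) x) (hb : ∀ l < m, g l (-1) = 0 ∧ g l 1 = 0)
    (hR : ∫ x in (-1 : ℝ)..1, g 0 x * g (m + m) x = (-1) ^ m * (R * ∫ x in (-1 : ℝ)..1, g 0 x ^ 2))
    (h0 : g 0 0 ≠ 0) : BumpProfile m R where
  g := g
  hasDerivAt := hg
  boundary := hb
  energy := by
    -- Moving `m` derivatives from one factor of `∫ (g m)²` to the other leaves `(-1)^m ∫ g₀ g₂ₘ`.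
    have h := integral_iterated_by_parts (a := -1) (b := 1) hg hg m hb m
    rw [hR, ← mul_assoc, ← mul_pow] at h
    simpa [← pow_two] using h
  pos := by
    have hc : Continuous (g 0) := continuous_iff_continuousAt.2 fun x => (hg 0 x).continuousAt
    exact intervalIntegral.integral_pos (by norm_num) (hc.pow 2).continuousOn
      (fun x _ => by positivity) ⟨0, by norm_num, by positivity⟩

lemma hasDerivAt_cos_chain (a : ℝ) (k : ℕ) (x : ℝ) :
    HasDerivAt (fun x => a ^ k * cos (a * x + k * (π / 2)))
      (a ^ (k + 1) * cos (a * x + (k + 1 : ℕ) * (π / 2))) x := by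
  have h1 : HasDerivAt (fun x : ℝ => a * x + k * (π / 2)) a x := by
    simpa using ((hasDerivAt_id x).const_mul a).add_const (k * (π / 2))
  refine (h1.cos.const_mul (a ^ k)).congr_deriv ?_
  have : a * x + ((k + 1 : ℕ) : ℝ) * (π / 2) = a * x + k * (π / 2) + π / 2 := by push_cast; ring
  rw [this, cos_add_pi_div_two]
  ring

lemma hasDerivAt_cosh_chain (a : ℝ) (k : ℕ) (x : ℝ) :
    HasDerivAt (fun x => a ^ k * ((exp (a * x) + (-1) ^ k * exp (-(a * x))) / 2))
      (a ^ (k + 1) * ((exp (a * x) + (-1) ^ (k + 1) * exp (-(a * x))) / 2)) x := by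
  have h1 : HasDerivAt (fun x : ℝ => a * x) a x := by
    simpa using (hasDerivAt_id x).const_mul a
  have h2 : HasDerivAt (fun x : ℝ => -(a * x)) (-a) x := h1.neg
  refine (((h1.exp.add (h2.exp.const_mul ((-1) ^ k))).div_const 2).const_mul
    (a ^ k)).congr_deriv ?_
  ring

/-- The profile `cos (π x / 2)`, the first Dirichlet eigenfunction. -/
def cosProfile : BumpProfile 1 ((π / 2) ^ 2) :=
  BumpProfile.ofIntegral (fun k x => (π / 2) ^ k * cos (π / 2 * x + k * (π / 2)))
    (hasDerivAt_cos_chain _)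
    (by
      intro l hl
      obtain rfl : l = 0 := by omega
      simp)
    (by
      rw [← intervalIntegral.integral_const_mul, ← intervalIntegral.integral_const_mul]
      refine intervalIntegral.integral_congr fun x _ => ?_
      have : π / 2 * x + ((1 + 1 : ℕ) : ℝ) * (π / 2) = π / 2 * x + π := by push_cast; ring
      simp only [this, cos_add_pi]
      simp
      ring)
    (by simp)

/-- The infimum is attained: there is no root in `(0, 1]`, so the positive roots form a closed set,
and it is nonempty by a sign change on `[1, π]`. -/
lemma σ_spec : 0 < σ ∧ cos σ * sinh σ + cosh σ * sin σ = 0 := by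
  set S := {t : ℝ | 0 < t ∧ cos t * sinh t + cosh t * sin t = 0} with hS
  have hcont : Continuous fun t : ℝ => cos t * sinh t + cosh t * sin t := by fun_prop
  have hpos : ∀ t, 0 < t → t ≤ 1 → 0 < cos t * sinh t + cosh t * sin t := by
    intro t h0 h1
    have := pi_gt_three
    have hc : 0 < cos t := cos_pos_of_mem_Ioo ⟨by linarith, by linarith⟩
    have hs : 0 < sin t := sin_pos_of_pos_of_lt_pi h0 (by linarith)
    have hsh : 0 < sinh t := sinh_pos_iff.2 h0
    have := cosh_pos t
    positivity
  have hne : S.Nonempty := by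
    have hpi := pi_gt_three
    have h := intermediate_value_Icc' (by linarith : (1 : ℝ) ≤ π) hcont.continuousOn
    obtain ⟨t, ht, hz⟩ := h (show (0 : ℝ) ∈ _ from ⟨by
      have := sinh_pos_iff.2 pi_pos
      simp only [cos_pi, sin_pi]
      linarith, (hpos 1 one_pos le_rfl).le⟩)
    exact ⟨t, by linarith [ht.1], hz⟩
  have hS1 : S = Set.Ici 1 ∩ {t | cos t * sinh t + cosh t * sin t = 0} := by
    ext t
    constructor
    · rintro ⟨h0, hz⟩
      exact ⟨le_of_not_ge fun h1 => (hpos t h0 h1).ne' hz, hz⟩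
    · rintro ⟨h1, hz⟩
      exact ⟨lt_of_lt_of_le one_pos h1, hz⟩
  have hcl : IsClosed S := by
    rw [hS1]
    exact isClosed_Ici.inter (isClosed_eq hcont continuous_const)
  exact hcl.csInf_mem hne ⟨0, fun t ht => ht.1.le⟩

/-- The profile `cosh σ cos (σ x) - cos σ cosh (σ x)`, the first clamped-beam eigenfunction. -/
def beamProfile : BumpProfile 2 (σ ^ 4) :=
  BumpProfile.ofIntegral
    (fun k x => cosh σ * (σ ^ k * cos (σ * x + k * (π / 2))) -
      cos σ * (σ ^ k * ((exp (σ * x) + (-1) ^ k * exp (-(σ * x))) / 2)))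
    (fun k x => ((hasDerivAt_cos_chain σ k x).const_mul _).sub
      ((hasDerivAt_cosh_chain σ k x).const_mul _))
    (by
      intro l hl
      -- The root equation for `σ` is exactly the vanishing of the first derivative at `±1`.
      have h := σ_spec.2
      interval_cases l
      · simp [cosh_eq]
        constructor <;> ring
      · simp [cosh_eq, sinh_eq, cos_add_pi_div_two] at h ⊢
        constructor
        · linear_combination σ * h
        · linear_combination -σ * h)
    (by
      rw [← intervalIntegral.integral_const_mul, ← intervalIntegral.integral_const_mul]
      refine intervalIntegral.integral_congr fun x _ => ?_
      have : σ * x + ((2 + 2 : ℕ) : ℝ) * (π / 2) = σ * x + 2 * π := by push_cast; ring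
      simp only [this, cos_add_two_pi]
      simp
      ring)
    (by
      have h1 := one_lt_cosh.2 σ_spec.1.ne'
      have h2 := cos_le_one σ
      simp
      linarith)

/-- The integral of `(1 - x²)^k` over `[-1, 1]`. -/
def betaIntegral (k : ℕ) : ℝ := ∫ x in (-1 : ℝ)..1, (1 - x ^ 2) ^ k

/-- Integrate the derivative of `x (1 - x²)^(k+1)`, which vanishes at `±1`, after writing `x² = 1 -
(1 - x²)`. -/
lemma betaIntegral_succ (k : ℕ) :
    (k + 3 / 2) * betaIntegral (k + 1) = (k + 1) * betaIntegral k := by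
  have hd : ∀ x : ℝ, HasDerivAt (fun x : ℝ => x * (1 - x ^ 2) ^ (k + 1))
      ((2 * k + 3) * (1 - x ^ 2) ^ (k + 1) - (2 * k + 2) * (1 - x ^ 2) ^ k) x := by
    intro x
    have h1 : HasDerivAt (fun x : ℝ => 1 - x ^ 2) (-(2 * x)) x := by
      simpa using ((hasDerivAt_id x).pow 2).const_sub 1
    refine ((hasDerivAt_id x).mul (h1.pow (k + 1))).congr_deriv ?_
    simp
    ring
  have h := intervalIntegral.integral_eq_sub_of_hasDerivAt (a := -1) (b := 1) (fun x _ => hd x)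
    ((by fun_prop : Continuous fun x : ℝ => (2 * k + 3) * (1 - x ^ 2) ^ (k + 1) -
      (2 * k + 2) * (1 - x ^ 2) ^ k).intervalIntegrable _ _)
  rw [intervalIntegral.integral_sub
    ((by fun_prop : Continuous fun x : ℝ => (2 * k + 3) * (1 - x ^ 2) ^ (k + 1)).intervalIntegrable
      _ _)
    ((by fun_prop : Continuous fun x : ℝ => (2 * k + 2) * (1 - x ^ 2) ^ k).intervalIntegrable _ _),
    intervalIntegral.integral_const_mul, intervalIntegral.integral_const_mul] at h
  simp only [betaIntegral]
  norm_num at h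
  linarith

lemma betaIntegral_mul_Gamma (k : ℕ) :
    betaIntegral k * Gamma (k + 3 / 2) = 2 * Gamma (3 / 2) * Gamma (k + 1) := by
  induction k with
  | zero => simp [betaIntegral]; norm_num
  | succ k ih =>
    have h1 : Gamma ((k + 1 : ℕ) + 3 / 2) = (k + 3 / 2) * Gamma (k + 3 / 2) := by
      rw [← Gamma_add_one (by positivity)]
      congr 1
      push_cast
      ring
    have h2 : Gamma ((k + 1 : ℕ) + 1) = (k + 1) * Gamma (k + 1) := by
      rw [← Gamma_add_one (by positivity)]
      push_cast
      rfl
    rw [h1, h2]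
    linear_combination Gamma (k + 3 / 2) * betaIntegral_succ k + (k + 1) * ih

/-- The energy quotient `Γ(m+1) Γ(2m+3/2) / Γ(m+3/2)` of the profile `(1 - x²)^m`. -/
def polyEnergy (m : ℕ) : ℝ := Gamma (m + 1) * Gamma (2 * m + 3 / 2) / Gamma (m + 3 / 2)

lemma polyEnergy_pos (m : ℕ) : 0 < polyEnergy m := by
  have h1 : 0 < Gamma ((m : ℝ) + 1) := Gamma_pos_of_pos (by positivity)
  have h2 : 0 < Gamma (2 * (m : ℝ) + 3 / 2) := Gamma_pos_of_pos (by positivity)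
  have h3 : 0 < Gamma ((m : ℝ) + 3 / 2) := Gamma_pos_of_pos (by positivity)
  unfold polyEnergy
  positivity

/-- The energy identity for `(1 - x²)^m`: its `2m`-th derivative is the constant `(-1)^m (2m)!`, so
the energy is the left side, while `betaIntegral (2 * m)` is the squared norm. -/
lemma factorial_mul_betaIntegral (m : ℕ) :
    ((2 * m).factorial : ℝ) * betaIntegral m = polyEnergy m * betaIntegral (2 * m) := by
  have h1 := betaIntegral_mul_Gamma m
  have h2 := betaIntegral_mul_Gamma (2 * m)
  rw [Gamma_nat_eq_factorial (2 * m)] at h2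
  push_cast at h2
  have h3 : Gamma ((m : ℝ) + 3 / 2) ≠ 0 := (Gamma_pos_of_pos (by positivity)).ne'
  rw [polyEnergy, div_mul_eq_mul_div, eq_div_iff h3]
  linear_combination ((2 * m).factorial : ℝ) * h1 - Gamma (m + 1) * h2

open Polynomial in
lemma iterate_derivative_one_sub_sq_pow (m : ℕ) :
    derivative^[m + m] ((1 - X ^ 2 : ℝ[X]) ^ m) = Polynomial.C ((-1) ^ m * ((2 * m).factorial : ℝ)) := by
  have e : (1 - X ^ 2 : ℝ[X]) ^ m = Polynomial.C ((-1) ^ m) * (X ^ 2 - 1) ^ m := by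
    rw [C_pow, ← mul_pow]
    congr 1
    simp
  have hmon : ((X ^ 2 - 1 : ℝ[X]) ^ m).Monic :=
    (monic_X_pow_sub_C (1 : ℝ) two_ne_zero).pow m
  have hdeg : ((X ^ 2 - 1 : ℝ[X]) ^ m).natDegree = m + m := by
    rw [natDegree_pow, show (X ^ 2 - 1 : ℝ[X]) = X ^ 2 - Polynomial.C 1 by simp, natDegree_X_pow_sub_C]
    ring
  rw [e, iterate_derivative_C_mul, C_mul]
  congr 1
  ext k
  rw [coeff_iterate_derivative, coeff_C]
  split_ifs with hk
  · subst hk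
    have := hmon.coeff_natDegree
    rw [hdeg] at this
    rw [zero_add, this, Nat.descFactorial_self, two_mul]
    simp
  · rw [coeff_eq_zero_of_natDegree_lt (by omega), smul_zero]

open Polynomial in
lemma eval_iterate_derivative_one_sub_sq_pow {m l : ℕ} (hl : l < m) {a : ℝ} (ha : 1 - a ^ 2 = 0) :
    (derivative^[l] ((1 - X ^ 2 : ℝ[X]) ^ m)).eval a = 0 := by
  have h1 : (X - Polynomial.C a) ∣ (1 - X ^ 2 : ℝ[X]) := by
    rw [dvd_iff_isRoot]
    simpa using ha
  have h2 := pow_sub_dvd_iterate_derivative_of_pow_dvd l (pow_dvd_pow_of_dvd h1 m)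
  have h3 : (X - Polynomial.C a) ∣ derivative^[l] ((1 - X ^ 2 : ℝ[X]) ^ m) :=
    (dvd_pow_self _ (by omega)).trans h2
  exact dvd_iff_isRoot.1 h3

open Polynomial in
/-- The profile `(1 - x²)^m`. -/
def polyProfile (m : ℕ) : BumpProfile m (polyEnergy m) :=
  BumpProfile.ofIntegral (fun k x => (derivative^[k] ((1 - X ^ 2 : ℝ[X]) ^ m)).eval x)
    (fun k x => by
      rw [Function.iterate_succ_apply']
      exact Polynomial.hasDerivAt _ x)
    (fun l hl => ⟨eval_iterate_derivative_one_sub_sq_pow hl (by norm_num),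
      eval_iterate_derivative_one_sub_sq_pow hl (by norm_num)⟩)
    (by
      have h := factorial_mul_betaIntegral m
      simp only [betaIntegral] at h
      simp only [iterate_derivative_one_sub_sq_pow, Function.iterate_zero, id, eval_C, eval_pow,
        eval_sub, eval_one, eval_X, intervalIntegral.integral_mul_const, ← pow_mul, mul_comm m 2]
      rw [← h]
      ring)
    (by simp)

lemma polyEnergy_succ (m : ℕ) :
    polyEnergy (m + 1) * (m + 3 / 2) =
      polyEnergy m * ((m + 1) * (2 * m + 5 / 2) * (2 * m + 3 / 2)) := by
  have h1 : Gamma ((m + 1 : ℕ) + 1) = (m + 1) * Gamma (m + 1) := by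
    rw [← Gamma_add_one (by positivity)]
    push_cast
    rfl
  have h2 : Gamma (2 * (m + 1 : ℕ) + 3 / 2) =
      (2 * m + 5 / 2) * ((2 * m + 3 / 2) * Gamma (2 * m + 3 / 2)) := by
    rw [← Gamma_add_one (by positivity), show (2 * m + 5 / 2 : ℝ) = 2 * m + 3 / 2 + 1 by ring,
      ← Gamma_add_one (by positivity)]
    congr 1
    push_cast
    ring
  have h3 : Gamma ((m + 1 : ℕ) + 3 / 2) = (m + 3 / 2) * Gamma (m + 3 / 2) := by
    rw [← Gamma_add_one (by positivity)]
    congr 1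
    push_cast
    ring
  have h4 : Gamma ((m : ℝ) + 3 / 2) ≠ 0 := (Gamma_pos_of_pos (by positivity)).ne'
  rw [polyEnergy, polyEnergy, h1, h2, h3]
  field_simp

/-- Induction on `m` through the ratio in `polyEnergy_succ`, which grows like `(2m)²`; the factor
`e²` gained at each step is absorbed because `e² < π²`. -/
lemma exp_mul_polyEnergy_le {m : ℕ} (hm : 1 ≤ m) :
    exp (2 * m) * polyEnergy m ≤ (π * (2 * m - 1 / 2)) ^ (2 * m) := by
  have he : exp 2 ≤ 7.39 := by
    have := exp_one_lt_d9
    have h0 := exp_pos 1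
    rw [show (2 : ℝ) = 1 + 1 by norm_num, exp_add]
    nlinarith
  have hpi : 9.8 ≤ π ^ 2 := by
    have := pi_gt_d4
    nlinarith
  induction m, hm using Nat.le_induction with
  | base =>
    have h0 : polyEnergy 0 = 1 := by
      have : Gamma (3 / 2 : ℝ) ≠ 0 := (Gamma_pos_of_pos (by positivity)).ne'
      simp [polyEnergy, div_self this]
    have h := polyEnergy_succ 0
    rw [h0] at h
    norm_num at h ⊢
    rw [mul_pow]
    have : polyEnergy 1 = 5 / 2 := by linarith
    rw [this]
    nlinarith
  | succ m hm ih =>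
    have hm' : (1 : ℝ) ≤ m := by exact_mod_cast hm
    have hR := polyEnergy_succ m
    have hRpos := polyEnergy_pos m
    set x : ℝ := (m : ℝ)
    have e1 : exp (2 * ((m + 1 : ℕ) : ℝ)) = exp 2 * exp (2 * x) := by
      rw [← exp_add]
      congr 1
      push_cast
      ring
    have e2 : polyEnergy (m + 1) =
        polyEnergy m * ((x + 1) * (2 * x + 5 / 2) * (2 * x + 3 / 2)) / (x + 3 / 2) := by
      rw [eq_div_iff (by positivity), hR]
    have e3 : (2 * ((m + 1 : ℕ) : ℝ) - 1 / 2) = 2 * x + 3 / 2 := by push_cast; ring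
    -- The quotient equals `2x + 3/2 + (1/4) / (x + 3/2)`; the constant `1.6` is attained at `x =
    -- 1`.
    have hratio : (x + 1) * (2 * x + 5 / 2) / (x + 3 / 2) ≤ 2 * x + 1.6 := by
      rw [div_le_iff₀ (by positivity)]
      nlinarith
    have hstep : exp 2 * ((x + 1) * (2 * x + 5 / 2) / (x + 3 / 2)) ≤ π ^ 2 * (2 * x + 3 / 2) := by
      have h1 : exp 2 * ((x + 1) * (2 * x + 5 / 2) / (x + 3 / 2)) ≤ 7.39 * (2 * x + 1.6) :=
        mul_le_mul he hratio (by positivity) (by norm_num)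
      nlinarith
    rw [e1, e2, e3]
    calc exp 2 * exp (2 * x) *
          (polyEnergy m * ((x + 1) * (2 * x + 5 / 2) * (2 * x + 3 / 2)) / (x + 3 / 2))
        = exp (2 * x) * polyEnergy m *
          (exp 2 * ((x + 1) * (2 * x + 5 / 2) / (x + 3 / 2)) * (2 * x + 3 / 2)) := by
          ring
      _ ≤ (π * (2 * x - 1 / 2)) ^ (2 * m) * (π ^ 2 * (2 * x + 3 / 2) * (2 * x + 3 / 2)) := by
          have : 0 ≤ 2 * x - 1 / 2 := by linarith
          gcongr
      _ ≤ (π * (2 * x + 3 / 2)) ^ (2 * m) * (π ^ 2 * (2 * x + 3 / 2) * (2 * x + 3 / 2)) := by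
          have : 0 ≤ 2 * x - 1 / 2 := by linarith
          have := pi_pos
          gcongr
          linarith
      _ = (π * (2 * x + 3 / 2)) ^ (2 * (m + 1)) := by ring

lemma C_pow_eq {m : ℕ} (hm : 0 < m) : C (2 * m) ^ (2 * m) = polyEnergy m / π ^ (2 * m) := by
  have e : Gamma (((2 * m : ℕ) : ℝ) / 2 + 1) * Gamma (((2 * m : ℕ) : ℝ) + 3 / 2) /
      (π ^ (2 * m) * Gamma ((((2 * m : ℕ) : ℝ) + 3) / 2)) = polyEnergy m / π ^ (2 * m) := by
    rw [polyEnergy, div_div, mul_comm (π ^ _)]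
    congr 3
    · push_cast; ring_nf
    · push_cast; ring_nf
    · push_cast; ring_nf
  have h0 : 0 ≤ polyEnergy m / π ^ (2 * m) := by
    have := polyEnergy_pos m
    have := pi_pos
    positivity
  rw [C, e, one_div, rpow_inv_natCast_pow h0 (by omega)]

/-! ### From the separation constants to a profile -/

/-- The threshold condition for a constant of the form `2 c d^{1/p}`. -/
lemma mul_lt_pow_of_const_lt {d p : ℕ} {c R X : ℝ} (hp : 0 < p) (hc : 0 ≤ c)
    (hR : R = (π * c) ^ p) (h : c * (d : ℝ) ^ (1 / (p : ℝ)) < X / 2) :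
    d * R < (π * X / 2) ^ p := by
  have h0 : (0 : ℝ) ≤ d := by positivity
  have e : (d : ℝ) * R = (π * (c * (d : ℝ) ^ (1 / (p : ℝ)))) ^ p := by
    rw [hR, ← mul_assoc, mul_pow _ ((d : ℝ) ^ _), one_div, rpow_inv_natCast_pow h0 hp.ne', mul_comm]
  have hpi := pi_pos
  rw [e, mul_div_assoc]
  gcongr

theorem exists_profile_of_sepConst_lt {d : ℕ} {X : ℝ} (h : sepConst d < X) :
    ∃ m R, Nonempty (BumpProfile m R) ∧ d * R < (π * X / 2) ^ (2 * m) := by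
  have h' := (lt_div_iff₀' two_pos).2 h
  have hpi := pi_pos
  rcases min_lt_iff.1 h' with h1 | h1
  · exact ⟨1, _, ⟨cosProfile⟩, mul_lt_pow_of_const_lt (c := 1 / 2) (by norm_num) (by norm_num)
      (by ring) (by simpa using h1)⟩
  rcases min_lt_iff.1 h1 with h2 | h2
  · have := σ_spec.1
    exact ⟨2, _, ⟨beamProfile⟩, mul_lt_pow_of_const_lt (c := σ / π) (by norm_num) (by positivity)
      (by field_simp) (by simpa using h2)⟩
  · have : Nonempty {p : ℕ // 0 < p ∧ Even p} := ⟨⟨2, by norm_num, by decide⟩⟩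
    obtain ⟨⟨p, hp0, hp⟩, h3⟩ := exists_lt_of_ciInf_lt h2
    obtain ⟨m, rfl⟩ := hp.two_dvd
    have hC : 0 ≤ C (2 * m) := by
      refine rpow_nonneg (div_nonneg (mul_nonneg ?_ ?_) (mul_nonneg (by positivity) ?_)) _ <;>
        exact (Gamma_pos_of_pos (by positivity)).le
    refine ⟨m, _, ⟨polyProfile m⟩, mul_lt_pow_of_const_lt (c := C (2 * m)) hp0 hC ?_ h3⟩
    rw [mul_pow, C_pow_eq (by omega)]
    field_simp

theorem exists_profile_of_log_lt {d : ℕ} (hd : 1 ≤ d) {X : ℝ} (h : 3 + 2 * log d < X) :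
    ∃ m R, Nonempty (BumpProfile m R) ∧ d * R < (π * X / 2) ^ (2 * m) := by
  have hd' : (1 : ℝ) ≤ d := by exact_mod_cast hd
  have hlog : 0 ≤ log d := log_nonneg hd'
  -- The lower bound on `m` gives `d ≤ exp (2m)`; the upper one gives `2m - 1/2 ≤ log d + 3/2 < X /
  -- 2`.
  obtain ⟨m, hm1, hm2, hm3⟩ : ∃ m : ℕ, 1 ≤ m ∧ log d ≤ 2 * m ∧ 2 * (m : ℝ) ≤ log d + 2 := by
    refine ⟨⌊log d / 2⌋₊ + 1, by omega, ?_, ?_⟩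
    · have := Nat.lt_floor_add_one (log d / 2)
      push_cast
      linarith
    · have := Nat.floor_le (a := log d / 2) (by positivity)
      push_cast
      linarith
  refine ⟨m, _, ⟨polyProfile m⟩, ?_⟩
  have hm1' : (1 : ℝ) ≤ m := by exact_mod_cast hm1
  have hpi := pi_pos
  calc d * polyEnergy m ≤ exp (2 * m) * polyEnergy m := by
        have := polyEnergy_pos m
        gcongr
        exact (log_le_iff_le_exp (by linarith)).1 hm2
    _ ≤ (π * (2 * m - 1 / 2)) ^ (2 * m) := exp_mul_polyEnergy_le hm1
    _ < (π * X / 2) ^ (2 * m) := by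
        refine pow_lt_pow_left₀ ?_ (mul_nonneg hpi.le (by linarith)) (by omega)
        rw [mul_div_assoc]
        exact mul_lt_mul_of_pos_left (by linarith) hpi

lemma sepConst_nonneg (d : ℕ) : 0 ≤ sepConst d := by
  refine mul_nonneg two_pos.le (le_min (by positivity) (le_min ?_ (Real.iInf_nonneg fun p => ?_)))
  · have := σ_spec.1
    have := pi_pos
    positivity
  · refine mul_nonneg (rpow_nonneg (div_nonneg (mul_nonneg ?_ ?_) (mul_nonneg (by positivity) ?_)) _)
      (by positivity) <;> exact (Gamma_pos_of_pos (by positivity)).le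

end Prony

/-! ### Row independence of the Vandermonde matrix, Lagrange polynomials, and the Toeplitz kernel -/

namespace Prony

open AddCircle
open scoped Matrix

lemma fourier_coe_eq_torusPoint {d : ℕ} (t : Fin d → ℝ) (k : ℕ) (i : Fin d) :
    (fourier (k : ℤ) (t i : UnitAddCircle) : ℂ) = torusPoint t i ^ k := by
  rw [fourier_coe_apply, torusPoint, ← Complex.exp_nat_mul]
  congr 1
  push_cast
  ring

lemma torusPoint_injOn {d : ℕ} : Set.InjOn (torusPoint (d := d)) (unitCube d) := by
  intro s hs t ht h
  funext i
  obtain ⟨k, hk⟩ := Complex.exp_eq_exp_iff_exists_int.1 (congrFun h i)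
  have h2 : (2 * Real.pi * Complex.I : ℂ) ≠ 0 := by simp [Real.pi_ne_zero]
  have h3 : (s i : ℂ) = t i + k :=
    mul_left_cancel₀ h2 (by rw [hk]; ring)
  have h4 : s i = t i + k := by exact_mod_cast h3
  have h5 : k = 0 := by
    have h6 : (k : ℝ) < 1 := by linarith [(hs i).2, (ht i).1]
    have h7 : (-1 : ℝ) < k := by linarith [(hs i).1, (ht i).2]
    have h8 : k < 1 := by exact_mod_cast h6
    have h9 : -1 < k := by exact_mod_cast h7
    omega
  rw [h4, h5]
  simp

lemma sepDist_nonneg {d M : ℕ} (t : Fin M → Fin d → ℝ) : 0 ≤ sepDist t :=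
  le_iInf fun _ => le_iInf fun _ => le_iInf fun _ => le_iInf fun _ =>
    EReal.coe_nonneg.2 (norm_nonneg _)

/-- Rounding each coordinate of `t j - t l` gives the integer shift that realizes the circle norms.
Only this inequality is needed to transfer the separation hypothesis to the torus. -/
lemma sepDist_le_norm_circle {d M : ℕ} (t : Fin M → Fin d → ℝ) {j l : Fin M} (h : j ≠ l) :
    sepDist t ≤ ((‖fun i => (t j i : UnitAddCircle) - (t l i : UnitAddCircle)‖ : ℝ) : EReal) := by
  refine (iInf_le_of_le j <| iInf_le_of_le l <| iInf_le_of_le h <|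
    iInf_le_of_le (fun i => -round (t j i - t l i)) le_rfl).trans (EReal.coe_le_coe_iff.2 ?_)
  rw [pi_norm_le_iff_of_nonneg (norm_nonneg _)]
  intro i
  refine le_trans (le_of_eq ?_) (norm_le_pi_norm _ i)
  rw [← coe_sub, UnitAddCircle.norm_eq]
  simp [sub_eq_add_neg]

lemma exists_profile {d : ℕ} (hd : 1 ≤ d) {X : ℝ} (h : sepConst d < X ∨ 3 + 2 * Real.log d < X) :
    ∃ m R, Nonempty (BumpProfile m R) ∧ d * R < (Real.pi * X / 2) ^ (2 * m) :=
  h.elim exists_profile_of_sepConst_lt (exists_profile_of_log_lt hd)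

/-- Under the separation condition the rows of the Vandermonde matrix of order `N` are linearly
independent. -/
theorem eq_zero_of_vecMul_vandermonde {d M N : ℕ} (hd : 1 ≤ d) (t : Fin M → Fin d → ℝ)
    (hsep : (sepConst d : EReal) < ((N : ℝ) : EReal) * sepDist t ∨
      ((3 + 2 * Real.log d : ℝ) : EReal) < ((N : ℝ) : EReal) * sepDist t)
    (u : Fin M → ℂ) (hu : u ᵥ* vandermonde N t = 0) : u = 0 := by
  have hmom : ∀ k : Fin d → ℕ, (∀ i, k i ≤ N) →
      ∑ j, u j * ∏ i, (fourier (k i : ℤ) (t j i : UnitAddCircle) : ℂ) = 0 := by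
    intro k hk
    have := congrFun hu (fun i => ⟨k i, Nat.lt_succ_of_le (hk i)⟩)
    simpa only [fourier_coe_eq_torusPoint, vandermonde, Matrix.vecMul, dotProduct,
      Matrix.of_apply, Pi.zero_apply] using this
  -- With at most one node `sepDist` is `⊤` and supplies no bump width; the zeroth moment alone
  -- gives `u = 0`.
  rcases subsingleton_or_nontrivial (Fin M) with hM | hM
  · have h0 := hmom 0 (by simp)
    funext j
    rw [Fintype.sum_subsingleton _ j] at h0
    simpa using h0
  -- The bump width `q` is the smallest torus distance between distinct nodes, a real number at most
  -- `1/2`.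
  · set ρ : Fin M × Fin M → ℝ :=
      fun p => ‖fun i => (t p.1 i : UnitAddCircle) - (t p.2 i : UnitAddCircle)‖
    obtain ⟨p, hp, hmin⟩ := (Finset.univ : Finset (Fin M)).offDiag.exists_min_image ρ (by
      obtain ⟨a, b, hab⟩ := exists_pair_ne (Fin M)
      exact ⟨(a, b), by simpa using hab⟩)
    have hp' : p.1 ≠ p.2 := by simpa using hp
    have hle : ((N : ℝ) : EReal) * sepDist t ≤ ((N * ρ p : ℝ) : EReal) := by
      rw [EReal.coe_mul]
      exact mul_le_mul_of_nonneg_left (sepDist_le_norm_circle t hp')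
        (EReal.coe_nonneg.2 (Nat.cast_nonneg N))
    have hX : sepConst d < N * ρ p ∨ 3 + 2 * Real.log d < N * ρ p :=
      hsep.imp (fun h => EReal.coe_lt_coe_iff.1 (h.trans_le hle))
        (fun h => EReal.coe_lt_coe_iff.1 (h.trans_le hle))
    have hNρ : 0 < N * ρ p := by
      have hlog : 0 ≤ Real.log d := Real.log_natCast_nonneg d
      rcases hX with h | h
      · exact (sepConst_nonneg d).trans_lt h
      · linarith
    have hρ : 0 < ρ p := pos_of_mul_pos_right hNρ (Nat.cast_nonneg N)
    have hρ1 : ρ p ≤ 1 := by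
      refine (pi_norm_le_iff_of_nonneg zero_le_one).2 fun i => ?_
      refine (norm_le_half_period 1 one_ne_zero).trans ?_
      norm_num
    obtain ⟨m, R, ⟨G⟩, hlt⟩ := exists_profile hd hX
    refine G.eq_zero_of_moments hρ hρ1 (N := N) (by rwa [mul_assoc Real.pi])
      (fun j i => (t j i : UnitAddCircle)) (fun j l hjl => ?_) u hmom
    by_contra! h
    have h1 : ρ p ≤ ρ (j, l) := hmin (j, l) (by simpa using hjl)
    exact absurd ((pi_norm_lt_iff hρ).2 h) (not_lt.2 h1)

lemma vandermonde_mulVec {d M n : ℕ} (t : Fin M → Fin d → ℝ) (p : Idx d n → ℂ) (j : Fin M) :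
    (vandermonde n t *ᵥ p) j = evalPoly p (torusPoint (t j)) := by
  simp only [vandermonde, Matrix.mulVec, dotProduct, Matrix.of_apply, evalPoly, mul_comm]

lemma exists_evalPoly_reindex {d N n : ℕ} (φ : Idx d N → Idx d n) (p : Idx d N → ℂ) :
    ∃ p' : Idx d n → ℂ, ∀ z, evalPoly p' z = ∑ k, p k * ∏ i, z i ^ (φ k i : ℕ) := by
  refine ⟨fun l => ∑ k, if φ k = l then p k else 0, fun z => ?_⟩
  simp only [evalPoly, Finset.sum_mul]
  rw [Finset.sum_comm]
  refine Finset.sum_congr rfl fun k _ => ?_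
  simp [ite_mul]

lemma exists_evalPoly_succ {d N : ℕ} (p : Idx d N → ℂ) :
    ∃ p' : Idx d (N + 1) → ℂ, ∀ z, evalPoly p' z = evalPoly p z :=
  exists_evalPoly_reindex (fun k i => (k i).castSucc) p

lemma exists_evalPoly_mul_coord {d N : ℕ} (i : Fin d) (p : Idx d N → ℂ) :
    ∃ p' : Idx d (N + 1) → ℂ, ∀ z, evalPoly p' z = z i * evalPoly p z := by
  obtain ⟨p', hp'⟩ := exists_evalPoly_reindex
    (fun (k : Idx d N) l => if l = i then (k l).succ else (k l).castSucc) p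
  refine ⟨p', fun z => ?_⟩
  rw [hp', evalPoly, Finset.mul_sum]
  refine Finset.sum_congr rfl fun k _ => ?_
  rw [mul_left_comm, ← Finset.mul_prod_erase _ _ (Finset.mem_univ i),
    ← Finset.mul_prod_erase _ (fun l => z l ^ (k l : ℕ)) (Finset.mem_univ i), if_pos rfl,
    Fin.val_succ, pow_succ', mul_assoc]
  congr 3
  refine Finset.prod_congr rfl fun l hl => ?_
  rw [if_neg (Finset.ne_of_mem_erase hl), Fin.val_castSucc]

lemma evalPoly_sub {d n : ℕ} (p r : Idx d n → ℂ) (z : Fin d → ℂ) :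
    evalPoly (p - r) z = evalPoly p z - evalPoly r z := by
  simp [evalPoly, sub_mul, Finset.sum_sub_distrib]

lemma evalPoly_smul {d n : ℕ} (a : ℂ) (p : Idx d n → ℂ) (z : Fin d → ℂ) :
    evalPoly (a • p) z = a * evalPoly p z := by
  simp [evalPoly, mul_assoc, Finset.mul_sum]

lemma evalPoly_sum {d n : ℕ} {ι : Type*} (s : Finset ι) (p : ι → Idx d n → ℂ) (z : Fin d → ℂ) :
    evalPoly (∑ j ∈ s, p j) z = ∑ j ∈ s, evalPoly (p j) z := by
  simp only [evalPoly, Finset.sum_apply, Finset.sum_mul]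
  exact Finset.sum_comm

lemma evalPoly_single_zero {d n : ℕ} (z : Fin d → ℂ) :
    evalPoly (Pi.single (0 : Idx d n) 1) z = 1 := by
  simp [evalPoly, Pi.single_apply]

/-- Lagrange polynomials of max-degree `N` exist when the Vandermonde matrix of order `N` has
independent rows. -/
lemma exists_lagrange {d M N : ℕ} {t : Fin M → Fin d → ℝ}
    (h : ∀ u, u ᵥ* vandermonde N t = 0 → u = 0) :
    ∃ p : Fin M → Idx d N → ℂ, ∀ j l,
      evalPoly (p j) (torusPoint (t l)) = if j = l then 1 else 0 := by
  have hinj : Function.Injective (vandermonde N t).vecMul :=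
    (injective_iff_map_eq_zero (Matrix.vecMulLinear (vandermonde N t))).2 h
  -- Independent rows mean full row rank, so interpolation at the nodes is solvable for all data.
  have hrank := (Matrix.vecMul_injective_iff.1 hinj).rank_matrix
  have hsurj : Function.Surjective (vandermonde N t).mulVecLin := by
    rw [← LinearMap.range_eq_top]
    refine Submodule.eq_top_of_finrank_eq ?_
    rw [← Matrix.rank, hrank, Module.finrank_fin_fun, Fintype.card_fin]
  choose p hp using fun j : Fin M => hsurj (Pi.single j 1)
  refine ⟨p, fun j l => ?_⟩
  rw [← vandermonde_mulVec, ← Matrix.mulVecLin_apply, hp, Pi.single_apply]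
  simp only [eq_comm]

/-- If the rows of the Vandermonde matrix of order `N` are independent, then the polynomials of
max-degree at most `N + 1` vanishing at all nodes have no further common zeros. -/
theorem exists_eq_torusPoint_of_forall_evalPoly_eq_zero {d M N : ℕ} {t : Fin M → Fin d → ℝ}
    (h : ∀ u, u ᵥ* vandermonde N t = 0 → u = 0) {z : Fin d → ℂ}
    (hz : ∀ p : Idx d (N + 1) → ℂ, (∀ l, evalPoly p (torusPoint (t l)) = 0) → evalPoly p z = 0) :
    ∃ j, torusPoint (t j) = z := by
  obtain ⟨p, hp⟩ := exists_lagrange h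
  choose p' hp' using fun j => exists_evalPoly_succ (p j)
  by_contra! hne
  have hzero : ∀ j, evalPoly (p j) z = 0 := by
    intro j
    obtain ⟨i, hi⟩ := Function.ne_iff.1 (hne j)
    obtain ⟨r, hr⟩ := exists_evalPoly_mul_coord i (p j)
    -- This is `(z i - z_j i) p j`: the linear factor kills node `j`, the Lagrange polynomial all
    -- others. Coordinate `i` is chosen so that the linear factor is nonzero at `z`.
    have h1 := hz (r - torusPoint (t j) i • p' j) fun l => by
      rw [evalPoly_sub, evalPoly_smul, hr, hp', hp]
      split_ifs with hjl
      · rw [hjl]; ring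
      · ring
    rw [evalPoly_sub, evalPoly_smul, hr, hp', ← sub_mul] at h1
    exact (mul_eq_zero.1 h1).resolve_left (sub_ne_zero.2 (Ne.symm hi))
  -- `1 - ∑ p j` vanishes at all nodes, yet equals `1` at `z`.
  have h2 := hz (Pi.single 0 1 - ∑ j, p' j) fun l => by
    rw [evalPoly_sub, evalPoly_single_zero, evalPoly_sum]
    simp [hp', hp]
  rw [evalPoly_sub, evalPoly_single_zero, evalPoly_sum] at h2
  simp [hp', hzero] at h2

/-- The columns of order `N` are among those of order `N + 1`. -/
lemma vecMul_vandermonde_succ {d M N : ℕ} {t : Fin M → Fin d → ℝ}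
    (h : ∀ u, u ᵥ* vandermonde N t = 0 → u = 0) :
    ∀ u, u ᵥ* vandermonde (N + 1) t = 0 → u = 0 := by
  refine fun u hu => h u (funext fun k => ?_)
  exact congrFun hu fun i => (k i).castSucc

/-- The kernel of the Toeplitz matrix consists of the polynomials vanishing at all nodes. -/
lemma mem_ker_toeplitz_iff {d M n : ℕ} {t : Fin M → Fin d → ℝ} {c : Fin M → ℂ}
    (hc : ∀ j, c j ≠ 0) (h : ∀ u, u ᵥ* vandermonde n t = 0 → u = 0) (p : Idx d n → ℂ) :
    p ∈ LinearMap.ker (toeplitz n (moment t c)).mulVecLin ↔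
      ∀ j, evalPoly p (torusPoint (t j)) = 0 := by
  rw [LinearMap.mem_ker, Matrix.mulVecLin_apply, toeplitz_moment, ← Matrix.mulVec_mulVec,
    ← Matrix.mulVec_mulVec]
  constructor
  · intro hp j
    -- Conjugation turns `Aᴴ v = 0` into a vanishing combination of the rows of `A`, so `v = D A p`
    -- is zero and the nonzero weights can be cancelled.
    have h1 := h (star (Matrix.diagonal c *ᵥ (vandermonde n t *ᵥ p))) (by
      have := congrArg star hp
      rwa [Matrix.star_mulVec, Matrix.conjTranspose_conjTranspose, star_zero] at this)
    have h2 := congrFun (star_eq_zero.1 h1) j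
    rw [Matrix.mulVec_diagonal, vandermonde_mulVec] at h2
    exact (mul_eq_zero.1 h2).resolve_left (hc j)
  · intro hp
    have : vandermonde n t *ᵥ p = 0 := funext fun j => by rw [vandermonde_mulVec, hp]; rfl
    rw [this, Matrix.mulVec_zero, Matrix.mulVec_zero]

end Prony

end

theorem corollary2p9 (d M n : ℕ) (hd : 1 ≤ d) (hM : 1 ≤ M)
    (t : Fin M → Fin d → ℝ) (ht : ∀ j, t j ∈ Prony.unitCube d) (hinj : Function.Injective t)
    (c : Fin M → ℂ) (hc : ∀ j, c j ≠ 0)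
    (hsep : (Prony.sepConst d : EReal) < (((n : ℝ) - 1 : ℝ) : EReal) * Prony.sepDist t ∨
      ((3 + 2 * Real.log (d : ℝ) : ℝ) : EReal) <
        (((n : ℝ) - 1 : ℝ) : EReal) * Prony.sepDist t) :
    Prony.commonZeros
        (LinearMap.ker (Prony.toeplitz n (Prony.moment t c)).mulVecLin :
          Set (Prony.Idx d n → ℂ)) =
      Set.range (fun j => Prony.torusPoint (t j)) ∧
    {s : Fin d → ℝ | s ∈ Prony.unitCube d ∧
        Prony.torusPoint s ∈ Prony.commonZeros
          (LinearMap.ker (Prony.toeplitz n (Prony.moment t c)).mulVecLin :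
            Set (Prony.Idx d n → ℂ))} =
      Set.range t := by
  -- For `n = 0` the factor `n - 1` is `-1`, and `-1 * sepDist t ≤ 0` even when `sepDist t = ⊤`,
  -- contradicting either lower bound.
  obtain ⟨N, rfl⟩ : ∃ N, n = N + 1 := by
    rcases n with _ | N
    · exfalso
      have hle : (((0 : ℕ) - 1 : ℝ) : EReal) * Prony.sepDist t ≤ 0 := by
        have : (((0 : ℕ) - 1 : ℝ) : EReal) = -1 := by norm_num
        rw [this, neg_one_mul]
        exact EReal.neg_le_zero.2 (Prony.sepDist_nonneg t)
      rcases hsep with h | h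
      · exact absurd (EReal.coe_nonneg.2 (Prony.sepConst_nonneg d)) (not_le.2 (h.trans_le hle))
      · have hlog := Real.log_natCast_nonneg d
        exact absurd (EReal.coe_nonneg.2 (by linarith : 0 ≤ 3 + 2 * Real.log (d : ℝ)))
          (not_le.2 (h.trans_le hle))
    · exact ⟨N, rfl⟩
  have hN : ((N + 1 : ℕ) : ℝ) - 1 = N := by push_cast; ring
  rw [hN] at hsep
  -- Independence is needed at order `n - 1`, not just `n`: one degree is spent on the linear
  -- factors that separate the nodes from other points.
  have hind := Prony.eq_zero_of_vecMul_vandermonde hd t hsep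
  have hker := Prony.mem_ker_toeplitz_iff hc (Prony.vecMul_vandermonde_succ hind)
  have hzeros : Prony.commonZeros
      (LinearMap.ker (Prony.toeplitz (N + 1) (Prony.moment t c)).mulVecLin :
        Set (Prony.Idx d (N + 1) → ℂ)) = Set.range (fun j => Prony.torusPoint (t j)) := by
    ext z
    constructor
    · intro hz
      exact Prony.exists_eq_torusPoint_of_forall_evalPoly_eq_zero hind
        fun p hp => hz p ((hker p).2 hp)
    · rintro ⟨j, rfl⟩ p hp
      exact (hker p).1 hp j
  refine ⟨hzeros, ?_⟩
  rw [hzeros]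
  ext s
  constructor
  · rintro ⟨hs, j, hj⟩
    exact ⟨j, Prony.torusPoint_injOn (ht j) hs hj⟩
  · rintro ⟨j, rfl⟩
    exact ⟨ht j, j, rfl⟩
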